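/- **Theorem.** Let $n\in\mathbb N$ and let $\mathscr H=\ell^2(\mathbb Z^2)\otimes\mathbb C^n$. Let $H=(H_{ij})_{i,j\in\mathbb Z^2}$, $H_{ij}\in M_n(\mathbb C)$, be a bounded self-adjoint operator on $\mathscr H$ with rapidly decaying matrix coefficients, i.e. $$\sup_{i,j\in\mathbb Z^2}\|H_{ij}\|\cdot d(i,j)^\mu<\infty\qquad\text{for every real }\mu\ge 0,$$ where $d$ is the Euclidean distance (and $0^0=1$). Let $E\in\mathbb R$, let $(a,b)\ni E$ be an open interval disjoint from the spectrum of $H$, and let $\varphi:\mathbb R\to\mathbb R$ be a continuous function with integral one and compact support contained in $(a,b)$. Let $$Y=\{(x,y)\in\mathbb Z^2\mid x\ge 0\},\qquad W=\{(x,y)\in\mathbb Z^2\mid y\ge 0\},$$ let $\chi_Y,\chi_W$ be the operators of multiplication by their indicator functions on $\mathscr H$, and put $\tilde H=\chi_Y H\chi_Y$. Then the operator $$\varphi(\tilde H)\cdot i[\tilde H,\chi_W]$$ on $\mathscr H$, with $\varphi(\tilde H)$ formed by continuous functional calculus, is trace class; i.e. for $T=\varphi(\tilde H)\cdot i[\tilde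 H,\chi_W]$ and every orthonormal basis $(e_k)$ of $\mathscr H$ one has $\sum_k\langle e_k,(T^*T)^{1/2}e_k\rangle<\infty$. -/

import Mathlib

open scoped ENNReal InnerProductSpace

noncomputable section

namespace EdgeTrace

universe u

/-- The Hilbert space `ℓ²(ℤ²) ⊗ ℂⁿ`, realised as the space of square-summable functions
`ℤ² → ℂⁿ`, with the structure of Mathlib's `lp`. -/
def LatticeSpace (n : ℕ) : Type :=
  lp (fun _ : ℤ × ℤ => EuclideanSpace ℂ (Fin n)) 2

instance (n : ℕ) : NormedAddCommGroup (LatticeSpace n) :=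
  inferInstanceAs (NormedAddCommGroup (lp (fun _ : ℤ × ℤ => EuclideanSpace ℂ (Fin n)) 2))

instance (n : ℕ) : InnerProductSpace ℂ (LatticeSpace n) :=
  inferInstanceAs (InnerProductSpace ℂ (lp (fun _ : ℤ × ℤ => EuclideanSpace ℂ (Fin n)) 2))

instance (n : ℕ) : CompleteSpace (LatticeSpace n) :=
  inferInstanceAs (CompleteSpace (lp (fun _ : ℤ × ℤ => EuclideanSpace ℂ (Fin n)) 2))

/-- The value `ψ(i) ∈ ℂⁿ` of a vector `ψ` at the site `i`, as a linear map in `ψ`. -/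
def eval {n : ℕ} (i : ℤ × ℤ) : LatticeSpace n →L[ℂ] EuclideanSpace ℂ (Fin n) :=
  lp.evalCLM ℂ (fun _ : ℤ × ℤ => EuclideanSpace ℂ (Fin n)) 2 i

/-- The vector `δ_j ⊗ v`, as a linear map in `v`. -/
def delta {n : ℕ} (j : ℤ × ℤ) : EuclideanSpace ℂ (Fin n) →L[ℂ] LatticeSpace n :=
  lp.singleContinuousLinearMap ℂ (fun _ : ℤ × ℤ => EuclideanSpace ℂ (Fin n)) 2 j

/-- The Euclidean distance on `ℤ² ⊂ ℝ²`. -/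
def latticeDist (i j : ℤ × ℤ) : ℝ :=
  √(((i.1 : ℝ) - j.1) ^ 2 + ((i.2 : ℝ) - j.2) ^ 2)

/-- Multiplication by the indicator function of `S ⊆ ℤ²`, on vectors. -/
def restrict {n : ℕ} (S : Set (ℤ × ℤ)) (ψ : LatticeSpace n) : LatticeSpace n :=
  ⟨S.indicator (fun i => eval i ψ), by
    have h : Memℓp (fun i => eval i ψ) 2 := ψ.2
    exact h.mono' (fun i => norm_indicator_le_norm_self (fun i => eval i ψ) i)⟩

theorem eval_restrict {n : ℕ} (S : Set (ℤ × ℤ)) (ψ : LatticeSpace n) (i : ℤ × ℤ) :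
    eval i (restrict S ψ) = S.indicator (fun i => eval i ψ) i := rfl

theorem ext_eval {n : ℕ} {ψ η : LatticeSpace n} (h : ∀ i, eval i ψ = eval i η) : ψ = η :=
  Subtype.ext (funext h)

theorem norm_restrict_le {n : ℕ} (S : Set (ℤ × ℤ)) (ψ : LatticeSpace n) :
    ‖restrict S ψ‖ ≤ ‖ψ‖ :=
  lp.norm_mono (E := fun _ : ℤ × ℤ => EuclideanSpace ℂ (Fin n)) (p := 2) (by norm_num)
    (fun i => norm_indicator_le_norm_self (fun i => eval i ψ) i)

/-- The operator `χ_S` of multiplication by the indicator function of `S ⊆ ℤ²`. -/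
def chi {n : ℕ} (S : Set (ℤ × ℤ)) : LatticeSpace n →L[ℂ] LatticeSpace n :=
  LinearMap.mkContinuous
    { toFun := restrict S
      map_add' := fun ψ η => ext_eval fun i => by
        by_cases hi : i ∈ S <;> simp [eval_restrict, hi]
      map_smul' := fun c ψ => ext_eval fun i => by
        by_cases hi : i ∈ S <;> simp [eval_restrict, hi] }
    1 (fun ψ => by
      rw [one_mul]
      exact norm_restrict_le S ψ)

/-- The matrix coefficient `T_{ij} : ℂⁿ → ℂⁿ` of an operator `T` on `ℓ²(ℤ²) ⊗ ℂⁿ`,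
that is `T_{ij} v = (T (δ_j ⊗ v))(i)`. -/
def coeff {n : ℕ} (T : LatticeSpace n →L[ℂ] LatticeSpace n) (i j : ℤ × ℤ) :
    EuclideanSpace ℂ (Fin n) →L[ℂ] EuclideanSpace ℂ (Fin n) :=
  eval i ∘L T ∘L delta j

/-- Rapid decay of matrix coefficients: `sup_{i,j} ‖T_{ij}‖ d(i,j)^μ < ∞` for every real
`μ ≥ 0` (with `0 ^ 0 = 1`). -/
def RapidDecay {n : ℕ} (T : LatticeSpace n →L[ℂ] LatticeSpace n) : Prop :=
  ∀ μ : ℝ, 0 ≤ μ →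
    BddAbove (Set.range fun p : (ℤ × ℤ) × (ℤ × ℤ) =>
      ‖coeff T p.1 p.2‖ * latticeDist p.1 p.2 ^ μ)

/-- The half space `Y = {(x, y) | x ≥ 0}`. -/
def halfY : Set (ℤ × ℤ) := {p | 0 ≤ p.1}

/-- The half space `W = {(x, y) | y ≥ 0}`. -/
def halfW : Set (ℤ × ℤ) := {p | 0 ≤ p.2}

/-- The contraction `χ_Y T χ_Y` of an operator to `Y`. -/
def contraction {n : ℕ} (Y : Set (ℤ × ℤ)) (T : LatticeSpace n →L[ℂ] LatticeSpace n) :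
    LatticeSpace n →L[ℂ] LatticeSpace n :=
  chi Y * T * chi Y

/-- A bounded operator `T` on a Hilbert space is trace class if `∑_k ⟨e_k, |T| e_k⟩ < ∞` for
every orthonormal basis `(e_k)`, where `|T| = (T* T)^{1/2}`. -/
def IsTraceClass {E : Type u} [NormedAddCommGroup E] [InnerProductSpace ℂ E] [CompleteSpace E]
    (T : E →L[ℂ] E) : Prop :=
  ∀ (ι : Type u) (e : HilbertBasis ι ℂ E),
    Summable fun k : ι => (⟪e k, CFC.abs T (e k)⟫_ℂ).re

end EdgeTrace

end

open scoped ENNReal InnerProductSpace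

namespace EdgeTrace

universe u v

/-! An operator `T` is trace class once its column norms `‖T f_j‖` over an orthonormal basis are
summable (`isTraceClass_of_summable_norm`). For `T = φ(H̃) C`, `C = [H̃, χ_W]`, it thus suffices to
bound the column at the site `(x, y)` by a multiple of `((1 + κ²x²)(1 + y²))⁻¹`. Decay in `y` comes
from `C`, whose coefficients connect the two sides of the line `y = 0`. Decay in `x` comes from the
gap: `φ(H̃)` is concentrated near the edge `x = 0`.

To make the latter quantitative, let `z` and `r` be the midpoint and half-length of the gap, and `R
= (H - z)⁻¹`, so `‖R‖ ≤ r⁻¹`. The compression `Q = χ_Y R χ_Y` inverts `H̃ - z` on `Y` up to the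
boundary term `K = χ_Y H χ_{Yᶜ} R χ_Y` (`contraction_sub_mul_compress`). Hence `F_m = φ(H̃)(H̃ -
z)^m` satisfies `F_m χ_Y = F_{m+1} Q + F_m K`, and iteration gives `φ(H̃) χ_Y = ∑_{m<M} F_m K Q^m +
F_M χ_Y Q^M`. As `φ` is supported in `|t - z| ≤ r'` with `r' < r`, the remainder is `O((r'/r)^M)`.
Continuity of `φ` is enough: no smooth functional calculus enters.

It remains to sum `F_m K Q^m C δ_j` with decay in `j`. Conjugating `R` by a polynomial weight of
small slope `κ` changes `H` by `O(κ)`, so the conjugated resolvent has norm at most `(r - κS)⁻¹`.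
For small `κ` this is below `1/r'` and the series still converges geometrically. The weight passes
from `C δ_j` through `Q^m` to `K`, where the jump across `x = 0` absorbs it
(`exists_norm_boundary_pow_commutator_le`). -/

/-! ### A trace class criterion -/

section TraceClass

variable {E : Type u} [NormedAddCommGroup E] [InnerProductSpace ℂ E]

/-- A family satisfies Parseval's identity if `‖x‖² = ∑_j |⟨f_j, x⟩|²` for every `x`. -/
def IsParseval {κ : Type v} (f : κ → E) : Prop :=
  ∀ x : E, ∑' j, ‖⟪f j, x⟫_ℂ‖ₑ ^ 2 = ‖x‖ₑ ^ 2

theorem isParseval_hilbertBasis {ι : Type v} (e : HilbertBasis ι ℂ E) : IsParseval e := by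
  intro x
  have h := (e.hasSum_inner_mul_inner x x).mapL (RCLike.reCLM (K := ℂ))
  have h' : HasSum (fun i => ‖⟪e i, x⟫_ℂ‖ ^ 2) (‖x‖ ^ 2) := by
    convert! h using 1
    · funext i
      have : ⟪x, e i⟫_ℂ * ⟪e i, x⟫_ℂ = ((‖⟪e i, x⟫_ℂ‖ ^ 2 : ℝ) : ℂ) := by
        rw [← inner_conj_symm x (e i), Complex.conj_mul']
        push_cast
        rfl
      rw [this]
      simp [-Complex.ofReal_pow]
    · exact (inner_self_eq_norm_sq (𝕜 := ℂ) x).symm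
  have h2 := ENNReal.ofReal_tsum_of_nonneg (fun i => sq_nonneg ‖⟪e i, x⟫_ℂ‖) h'.summable
  rw [h'.tsum_eq] at h2
  simpa [ENNReal.ofReal_pow, ofReal_norm] using h2.symm

variable [CompleteSpace E]

/-- The Hilbert–Schmidt norm of a self-adjoint operator does not depend on the family. -/
theorem tsum_enorm_sq_eq_of_isParseval {ι : Type*} {κ : Type*} {e : ι → E} {f : κ → E}
    (he : IsParseval e) (hf : IsParseval f) {S : E →L[ℂ] E} (hS : IsSelfAdjoint S) :
    ∑' i, ‖S (e i)‖ₑ ^ 2 = ∑' j, ‖S (f j)‖ₑ ^ 2 := by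
  -- Both sides equal the double sum of `‖⟪f j, S (e i)⟫‖²`; in `ℝ≥0∞` the interchange needs no
  -- summability.
  have hsymm := (ContinuousLinearMap.isSelfAdjoint_iff_isSymmetric.mp hS)
  calc ∑' i, ‖S (e i)‖ₑ ^ 2 = ∑' i, ∑' j, ‖⟪f j, S (e i)⟫_ℂ‖ₑ ^ 2 := by simp_rw [hf _]
    _ = ∑' j, ∑' i, ‖⟪f j, S (e i)⟫_ℂ‖ₑ ^ 2 := ENNReal.tsum_comm
    _ = ∑' j, ∑' i, ‖⟪e i, S (f j)⟫_ℂ‖ₑ ^ 2 := by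
        refine tsum_congr fun j => tsum_congr fun i => ?_
        have h : ⟪f j, S (e i)⟫_ℂ = ⟪S (f j), e i⟫_ℂ := (hsymm (f j) (e i)).symm
        rw [h, ← ofReal_norm, norm_inner_symm, ofReal_norm]
    _ = ∑' j, ‖S (f j)‖ₑ ^ 2 := by simp_rw [he _]

theorem norm_cfcAbs_apply (T : E →L[ℂ] E) (x : E) : ‖CFC.abs T x‖ = ‖T x‖ := by
  have hsa : IsSelfAdjoint (CFC.abs T) := (CFC.abs_nonneg T).isSelfAdjoint
  have hsymm := (ContinuousLinearMap.isSelfAdjoint_iff_isSymmetric.mp hsa)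
  have h1 : ⟪CFC.abs T x, CFC.abs T x⟫_ℂ = ⟪T x, T x⟫_ℂ := by
    calc ⟪CFC.abs T x, CFC.abs T x⟫_ℂ = ⟪x, CFC.abs T (CFC.abs T x)⟫_ℂ := hsymm x _
      _ = ⟪x, (CFC.abs T * CFC.abs T) x⟫_ℂ := rfl
      _ = ⟪x, (star T * T) x⟫_ℂ := by rw [CFC.abs_mul_abs]
      _ = ⟪x, ContinuousLinearMap.adjoint T (T x)⟫_ℂ := rfl
      _ = ⟪T x, T x⟫_ℂ := ContinuousLinearMap.adjoint_inner_right T x (T x)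
  rw [inner_self_eq_norm_sq_to_K, inner_self_eq_norm_sq_to_K] at h1
  have h2 : ‖CFC.abs T x‖ ^ 2 = ‖T x‖ ^ 2 := by exact_mod_cast h1
  exact (sq_eq_sq₀ (norm_nonneg _) (norm_nonneg _)).mp h2

/-- `T` is trace class as soon as `∑_j ‖T f_j‖ < ∞` for one bounded Parseval family `f`. -/
theorem isTraceClass_of_summable_norm {κ : Type*} {f : κ → E} (hf : IsParseval f)
    (hf1 : ∀ j, ‖f j‖ ≤ 1) {T : E →L[ℂ] E} (hT : Summable fun j => ‖T (f j)‖) :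
    IsTraceClass T := by
  intro ι e
  have habs := CFC.abs_nonneg T
  -- With `S = |T|^{1/2}`, the trace sum of `|T|` is a squared Hilbert–Schmidt norm of `S`, which
  -- may be computed in `f` instead of `e`.
  set S := CFC.sqrt (CFC.abs T) with hSdef
  have hS : IsSelfAdjoint S := (CFC.sqrt_nonneg _).isSelfAdjoint
  have hSS : S * S = CFC.abs T := CFC.sqrt_mul_sqrt_self _ habs
  have hsymm := (ContinuousLinearMap.isSelfAdjoint_iff_isSymmetric.mp hS)
  have key : ∀ x, (⟪x, CFC.abs T x⟫_ℂ).re = ‖S x‖ ^ 2 := by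
    intro x
    rw [← hSS]
    have : ⟪x, (S * S) x⟫_ℂ = ⟪S x, S x⟫_ℂ := (hsymm x (S x)).symm
    rw [this]
    exact inner_self_eq_norm_sq (𝕜 := ℂ) (S x)
  have hle : ∀ j, ‖S (f j)‖ ^ 2 ≤ ‖T (f j)‖ := by
    intro j
    rw [← key]
    calc (⟪f j, CFC.abs T (f j)⟫_ℂ).re ≤ ‖f j‖ * ‖CFC.abs T (f j)‖ :=
          re_inner_le_norm (𝕜 := ℂ) _ _
      _ ≤ 1 * ‖T (f j)‖ := by
          rw [norm_cfcAbs_apply]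
          gcongr
          exact hf1 j
      _ = ‖T (f j)‖ := one_mul _
  have hfin : ∑' i, ‖S (e i)‖ₑ ^ 2 ≠ ∞ := by
    rw [tsum_enorm_sq_eq_of_isParseval (isParseval_hilbertBasis e) hf hS]
    have hs : Summable fun j => ‖S (f j)‖ ^ 2 :=
      Summable.of_nonneg_of_le (fun j => sq_nonneg _) hle hT
    have := hs.tsum_ofReal_ne_top
    simpa [ENNReal.ofReal_pow, ofReal_norm] using this
  simp_rw [key]
  have := ENNReal.summable_toReal hfin
  simpa using this

end TraceClass

/-! ### Vectors and operators on the lattice -/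

section Lattice

variable {n : ℕ}

theorem hasSum_norm_eval_sq (ψ : LatticeSpace n) :
    HasSum (fun i => ‖eval i ψ‖ ^ 2) (‖ψ‖ ^ 2) := by
  have h := lp.hasSum_norm (E := fun _ : ℤ × ℤ => EuclideanSpace ℂ (Fin n)) (p := 2)
    (by norm_num) ψ
  simpa only [ENNReal.toReal_ofNat, Real.rpow_ofNat] using! h

theorem tsum_enorm_eval_sq (ψ : LatticeSpace n) :
    ∑' i, ‖eval i ψ‖ₑ ^ 2 = ‖ψ‖ₑ ^ 2 := by
  have h' := hasSum_norm_eval_sq ψ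
  have h2 := ENNReal.ofReal_tsum_of_nonneg (fun i => sq_nonneg ‖eval i ψ‖) h'.summable
  rw [h'.tsum_eq] at h2
  simpa [ENNReal.ofReal_pow, ofReal_norm] using h2.symm

theorem eval_delta (i j : ℤ × ℤ) (v : EuclideanSpace ℂ (Fin n)) :
    eval i (delta j v) = if i = j then v else 0 := by
  change (lp.single 2 j v : lp (fun _ : ℤ × ℤ => EuclideanSpace ℂ (Fin n)) 2) i = _
  rw [lp.single_apply]
  split_ifs with h
  · subst h; exact Pi.single_eq_same _ _
  · exact Pi.single_eq_of_ne h _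

theorem norm_delta (j : ℤ × ℤ) (v : EuclideanSpace ℂ (Fin n)) : ‖delta j v‖ = ‖v‖ :=
  lp.norm_single (E := fun _ : ℤ × ℤ => EuclideanSpace ℂ (Fin n)) (p := 2) (by norm_num) j v

theorem hasSum_delta (ψ : LatticeSpace n) : HasSum (fun j => delta j (eval j ψ)) ψ :=
  lp.hasSum_single (E := fun _ : ℤ × ℤ => EuclideanSpace ℂ (Fin n)) (p := 2) (by norm_num) ψ

theorem inner_delta (j : ℤ × ℤ) (v : EuclideanSpace ℂ (Fin n)) (ψ : LatticeSpace n) :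
    ⟪delta j v, ψ⟫_ℂ = ⟪v, eval j ψ⟫_ℂ :=
  lp.inner_single_left (𝕜 := ℂ) (G := fun _ : ℤ × ℤ => EuclideanSpace ℂ (Fin n)) j v ψ

/-- The canonical orthonormal family of `ℓ²(ℤ²) ⊗ ℂⁿ`. -/
noncomputable def deltaSingle (p : (ℤ × ℤ) × Fin n) : LatticeSpace n :=
  delta p.1 (EuclideanSpace.single p.2 1)

theorem norm_deltaSingle (p : (ℤ × ℤ) × Fin n) : ‖deltaSingle p‖ = 1 := by
  simp [deltaSingle, norm_delta]

theorem isParseval_deltaSingle : IsParseval (deltaSingle (n := n)) := by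
  intro x
  rw [ENNReal.tsum_prod', ← tsum_enorm_eval_sq]
  congr! 2 with j
  have h := EuclideanSpace.norm_sq_eq (eval j x)
  have h2 : ‖eval j x‖ₑ ^ 2 = ∑ k, ‖(eval j x) k‖ₑ ^ 2 := by
    have := congrArg ENNReal.ofReal h
    rw [ENNReal.ofReal_sum_of_nonneg (fun k _ => sq_nonneg _)] at this
    simpa [ENNReal.ofReal_pow, ofReal_norm] using this
  rw [h2, tsum_fintype]
  simp [deltaSingle, inner_delta, EuclideanSpace.inner_single_left]

theorem hasSum_coeff (A : LatticeSpace n →L[ℂ] LatticeSpace n) (ψ : LatticeSpace n) (i : ℤ × ℤ) :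
    HasSum (fun j => coeff A i j (eval j ψ)) (eval i (A ψ)) :=
  (hasSum_delta ψ).mapL (eval i ∘L A)

theorem ENNReal_two_mul_le_sq_add_sq (a b : ℝ≥0∞) : 2 * (a * b) ≤ a ^ 2 + b ^ 2 := by
  induction a with
  | top => simp
  | coe a =>
    induction b with
    | top => simp
    | coe b => exact_mod_cast (by simpa [mul_assoc] using two_mul_le_add_sq a b)

/-- Cauchy–Schwarz with weights. -/
theorem ENNReal_tsum_mul_sq_le {ι : Type*} (k a : ι → ℝ≥0∞) :
    (∑' j, k j * a j) ^ 2 ≤ (∑' j, k j) * ∑' j, k j * a j ^ 2 := by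
  have h : 2 * (∑' j, k j * a j) ^ 2 ≤ 2 * ((∑' j, k j) * ∑' j, k j * a j ^ 2) := by
    -- Doubling lets `2 a_i a_j ≤ a_i² + a_j²` act on the symmetric double sum, without square
    -- roots.
    calc 2 * (∑' j, k j * a j) ^ 2
        = ∑' i, ∑' j, k i * k j * (2 * (a i * a j)) := by
          rw [sq, ← ENNReal.tsum_mul_right, ← ENNReal.tsum_mul_left]
          congr! 2 with i
          rw [← ENNReal.tsum_mul_left, ← ENNReal.tsum_mul_left]
          congr! 2 with j
          ring
      _ ≤ ∑' i, ∑' j, k i * k j * (a i ^ 2 + a j ^ 2) := by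
          gcongr
          exact ENNReal_two_mul_le_sq_add_sq _ _
      _ = ∑' i, ∑' j, (k i * a i ^ 2 * k j + k i * (k j * a j ^ 2)) := by
          congr! 4
          ring
      _ = 2 * ((∑' j, k j) * ∑' j, k j * a j ^ 2) := by
          simp_rw [ENNReal.tsum_add, ENNReal.tsum_mul_left, ENNReal.tsum_mul_right]
          ring
  exact (ENNReal.mul_le_mul_iff_right (by norm_num) (by norm_num)).mp h

/-- **Schur test** for a convolution bound. -/
theorem opNorm_le_of_coeff_le {A : LatticeSpace n →L[ℂ] LatticeSpace n} {k : ℤ × ℤ → ℝ}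
    (hk : Summable k) (hA : ∀ i j, ‖coeff A i j‖ ≤ k (i - j)) : ‖A‖ ≤ ∑' s, k s := by
  have hk0 : ∀ s, 0 ≤ k s := fun s => by simpa using (norm_nonneg _).trans (hA s 0)
  refine ContinuousLinearMap.opNorm_le_bound _ (tsum_nonneg hk0) fun ψ => ?_
  set q : ℤ × ℤ → ℝ≥0∞ := fun s => ENNReal.ofReal (k s) with hq
  have hrow : ∀ i, ∑' j, q (i - j) = ∑' s, q s := fun i => (Equiv.subLeft i).tsum_eq q
  have hcol : ∀ j, ∑' i, q (i - j) = ∑' s, q s := fun j => (Equiv.subRight j).tsum_eq q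
  have h1 : ∀ i, ‖eval i (A ψ)‖ₑ ≤ ∑' j, q (i - j) * ‖eval j ψ‖ₑ := by
    intro i
    rw [← (hasSum_coeff A ψ i).tsum_eq]
    refine enorm_tsum_le_tsum_enorm.trans ?_
    gcongr with j
    rw [← ofReal_norm, ← ofReal_norm (eval j ψ), ← ENNReal.ofReal_mul (hk0 _)]
    refine ENNReal.ofReal_le_ofReal ((ContinuousLinearMap.le_opNorm _ _).trans ?_)
    gcongr
    exact hA i j
  have h2 : ‖A ψ‖ₑ ^ 2 ≤ ((∑' s, q s) * ‖ψ‖ₑ) ^ 2 := by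
    calc ‖A ψ‖ₑ ^ 2 = ∑' i, ‖eval i (A ψ)‖ₑ ^ 2 := (tsum_enorm_eval_sq _).symm
      _ ≤ ∑' i, (∑' j, q (i - j) * ‖eval j ψ‖ₑ) ^ 2 := by
          gcongr with i
          exact h1 i
      _ ≤ ∑' i, (∑' j, q (i - j)) * ∑' j, q (i - j) * ‖eval j ψ‖ₑ ^ 2 := by
          gcongr with i
          exact ENNReal_tsum_mul_sq_le _ _
      _ = (∑' s, q s) * ∑' j, ∑' i, q (i - j) * ‖eval j ψ‖ₑ ^ 2 := by
          simp_rw [hrow, ENNReal.tsum_mul_left]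
          rw [ENNReal.tsum_comm]
      _ = ((∑' s, q s) * ‖ψ‖ₑ) ^ 2 := by
          simp_rw [ENNReal.tsum_mul_right, hcol, ENNReal.tsum_mul_left, tsum_enorm_eval_sq]
          ring
  have h3 : ‖A ψ‖ₑ ≤ (∑' s, q s) * ‖ψ‖ₑ := (ENNReal.pow_le_pow_left_iff two_ne_zero).mp h2
  rw [hq, ← ENNReal.ofReal_tsum_of_nonneg hk0 hk, ← ofReal_norm, ← ofReal_norm,
    ← ENNReal.ofReal_mul (tsum_nonneg hk0)] at h3
  exact (ENNReal.ofReal_le_ofReal_iff (mul_nonneg (tsum_nonneg hk0) (norm_nonneg _))).mp h3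

end Lattice

/-! ### Multiplication operators and matrix coefficients -/

section Multiplication

variable {n : ℕ}

/-- Multiplication by a bounded real function on the lattice. -/
noncomputable def mulOp (f : ℤ × ℤ → ℝ) (hf : ∃ B, ∀ i, |f i| ≤ B) :
    LatticeSpace n →L[ℂ] LatticeSpace n :=
  have hle : ∀ (ψ : LatticeSpace n) (i : ℤ × ℤ),
      ‖(f i : ℂ) • eval i ψ‖ ≤ ‖eval i ((hf.choose : ℂ) • ψ)‖ := fun ψ i => by
    rw [map_smul, norm_smul, norm_smul, Complex.norm_real, Complex.norm_real]
    gcongr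
    exact (hf.choose_spec i).trans (le_abs_self _)
  LinearMap.mkContinuous
    { toFun := fun ψ => ⟨fun i => (f i : ℂ) • eval i ψ,
        Memℓp.mono' (((hf.choose : ℂ) • ψ : LatticeSpace n).2) (hle ψ)⟩
      map_add' := fun ψ η => ext_eval fun i => by
        change (f i : ℂ) • eval i (ψ + η) = (f i : ℂ) • eval i ψ + (f i : ℂ) • eval i η
        rw [map_add, smul_add]
      map_smul' := fun c ψ => ext_eval fun i => by
        change (f i : ℂ) • eval i (c • ψ) = c • (f i : ℂ) • eval i ψ
        rw [map_smul, smul_comm] }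
    ‖(hf.choose : ℂ)‖ (fun ψ => by
      rw [← norm_smul]
      exact lp.norm_mono (E := fun _ : ℤ × ℤ => EuclideanSpace ℂ (Fin n)) (p := 2) (by norm_num)
        (hle ψ))

theorem eval_mulOp (f : ℤ × ℤ → ℝ) (hf : ∃ B, ∀ i, |f i| ≤ B) (ψ : LatticeSpace n)
    (i : ℤ × ℤ) : eval i (mulOp f hf ψ) = (f i : ℂ) • eval i ψ := rfl

open Classical in
theorem eval_chi (S : Set (ℤ × ℤ)) (ψ : LatticeSpace n) (i : ℤ × ℤ) :
    eval i (chi S ψ) = if i ∈ S then eval i ψ else 0 :=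
  Set.indicator_apply ..

theorem mulOp_delta (f : ℤ × ℤ → ℝ) (hf : ∃ B, ∀ i, |f i| ≤ B) (j : ℤ × ℤ)
    (v : EuclideanSpace ℂ (Fin n)) : mulOp f hf (delta j v) = (f j : ℂ) • delta j v := by
  refine ext_eval fun i => ?_
  rw [eval_mulOp, map_smul, eval_delta]
  split_ifs with h <;> simp [h]

open Classical in
theorem chi_delta (S : Set (ℤ × ℤ)) (j : ℤ × ℤ) (v : EuclideanSpace ℂ (Fin n)) :
    chi S (delta j v) = if j ∈ S then delta j v else 0 := by
  refine ext_eval fun i => ?_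
  rw [eval_chi]
  by_cases hij : i = j
  · subst hij; split_ifs <;> simp
  · split_ifs <;> simp [eval_delta, hij]

theorem coeff_mulOp_mul (f : ℤ × ℤ → ℝ) (hf : ∃ B, ∀ i, |f i| ≤ B)
    (A : LatticeSpace n →L[ℂ] LatticeSpace n) (i j : ℤ × ℤ) :
    coeff (mulOp f hf * A) i j = (f i : ℂ) • coeff A i j := rfl

theorem coeff_mul_mulOp (f : ℤ × ℤ → ℝ) (hf : ∃ B, ∀ i, |f i| ≤ B)
    (A : LatticeSpace n →L[ℂ] LatticeSpace n) (i j : ℤ × ℤ) :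
    coeff (A * mulOp f hf) i j = (f j : ℂ) • coeff A i j := by
  ext1 v
  change eval i (A (mulOp f hf (delta j v))) = (f j : ℂ) • eval i (A (delta j v))
  rw [mulOp_delta, map_smul, map_smul]

open Classical in
theorem coeff_chi_mul (S : Set (ℤ × ℤ)) (A : LatticeSpace n →L[ℂ] LatticeSpace n) (i j : ℤ × ℤ) :
    coeff (chi S * A) i j = if i ∈ S then coeff A i j else 0 := by
  ext1 v
  change eval i (chi S (A (delta j v))) = _
  rw [eval_chi]
  split_ifs <;> rfl

open Classical in
theorem coeff_mul_chi (S : Set (ℤ × ℤ)) (A : LatticeSpace n →L[ℂ] LatticeSpace n) (i j : ℤ × ℤ) :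
    coeff (A * chi S) i j = if j ∈ S then coeff A i j else 0 := by
  ext1 v
  change eval i (A (chi S (delta j v))) = _
  rw [chi_delta]
  split_ifs
  · rfl
  · simp

theorem coeff_sub (A B : LatticeSpace n →L[ℂ] LatticeSpace n) (i j : ℤ × ℤ) :
    coeff (A - B) i j = coeff A i j - coeff B i j := by
  ext1 v
  simp [coeff]

theorem mulOp_mul_mulOp_eq_one {f g : ℤ × ℤ → ℝ} (hf : ∃ B, ∀ i, |f i| ≤ B)
    (hg : ∃ B, ∀ i, |g i| ≤ B) (h : ∀ i, f i * g i = 1) :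
    (mulOp f hf * mulOp g hg : LatticeSpace n →L[ℂ] LatticeSpace n) = 1 := by
  ext1 ψ
  refine ext_eval fun i => ?_
  change (f i : ℂ) • (g i : ℂ) • eval i ψ = eval i ψ
  rw [smul_smul, ← Complex.ofReal_mul, h, Complex.ofReal_one, one_smul]

theorem commute_mulOp_chi (f : ℤ × ℤ → ℝ) (hf : ∃ B, ∀ i, |f i| ≤ B) (S : Set (ℤ × ℤ)) :
    Commute (mulOp f hf : LatticeSpace n →L[ℂ] LatticeSpace n) (chi S) := by
  classical
  ext1 ψ
  refine ext_eval fun i => ?_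
  change (f i : ℂ) • eval i (chi S ψ) = eval i (chi S (mulOp f hf ψ))
  rw [eval_chi, eval_chi, eval_mulOp]
  split_ifs <;> simp

theorem norm_chi_le (S : Set (ℤ × ℤ)) :
    ‖(chi S : LatticeSpace n →L[ℂ] LatticeSpace n)‖ ≤ 1 :=
  LinearMap.mkContinuous_norm_le _ zero_le_one _

theorem chi_mul_chi_self (S : Set (ℤ × ℤ)) :
    (chi S * chi S : LatticeSpace n →L[ℂ] LatticeSpace n) = chi S := by
  classical
  ext1 ψ
  refine ext_eval fun i => ?_
  change eval i (chi S (chi S ψ)) = eval i (chi S ψ)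
  simp only [eval_chi]
  split_ifs <;> rfl

theorem chi_mul_chi_compl (S : Set (ℤ × ℤ)) :
    (chi S * chi Sᶜ : LatticeSpace n →L[ℂ] LatticeSpace n) = 0 := by
  classical
  ext1 ψ
  refine ext_eval fun i => ?_
  change eval i (chi S (chi Sᶜ ψ)) = 0
  by_cases h : i ∈ S <;> simp [eval_chi, h]

theorem chi_add_chi_compl (S : Set (ℤ × ℤ)) :
    (chi S + chi Sᶜ : LatticeSpace n →L[ℂ] LatticeSpace n) = 1 := by
  classical
  ext1 ψ
  refine ext_eval fun i => ?_
  change eval i (chi S ψ + chi Sᶜ ψ) = eval i ψ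
  by_cases h : i ∈ S <;> simp [eval_chi, h]

theorem commute_chi_chi (S T : Set (ℤ × ℤ)) :
    Commute (chi S : LatticeSpace n →L[ℂ] LatticeSpace n) (chi T) := by
  classical
  ext1 ψ
  refine ext_eval fun i => ?_
  change eval i (chi S (chi T ψ)) = eval i (chi T (chi S ψ))
  simp only [eval_chi]
  split_ifs <;> rfl

theorem isSelfAdjoint_chi (S : Set (ℤ × ℤ)) :
    IsSelfAdjoint (chi S : LatticeSpace n →L[ℂ] LatticeSpace n) := by
  classical
  rw [ContinuousLinearMap.isSelfAdjoint_iff_isSymmetric]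
  intro ψ η
  have h : ∀ ψ η : LatticeSpace n, ⟪ψ, η⟫_ℂ = ∑' i, ⟪eval i ψ, eval i η⟫_ℂ := fun ψ η =>
    lp.inner_eq_tsum (𝕜 := ℂ) (G := fun _ : ℤ × ℤ => EuclideanSpace ℂ (Fin n)) ψ η
  change ⟪chi S ψ, η⟫_ℂ = ⟪ψ, chi S η⟫_ℂ
  rw [h, h]
  refine tsum_congr fun i => ?_
  rw [eval_chi, eval_chi]
  split_ifs <;> simp

theorem isSelfAdjoint_contraction (S : Set (ℤ × ℤ)) {H : LatticeSpace n →L[ℂ] LatticeSpace n}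
    (hH : IsSelfAdjoint H) : IsSelfAdjoint (contraction S H) := by
  have h := hH.conjugate (chi S)
  rwa [(isSelfAdjoint_chi S).star_eq] at h

end Multiplication

/-! ### Distances and summability on the lattice -/

theorem latticeDist_nonneg (i j : ℤ × ℤ) : 0 ≤ latticeDist i j := Real.sqrt_nonneg _

theorem abs_fst_sub_le_latticeDist (i j : ℤ × ℤ) : |(i.1 : ℝ) - j.1| ≤ latticeDist i j :=
  Real.abs_le_sqrt (le_add_of_nonneg_right (sq_nonneg _))

theorem abs_snd_sub_le_latticeDist (i j : ℤ × ℤ) : |(i.2 : ℝ) - j.2| ≤ latticeDist i j :=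
  Real.abs_le_sqrt (le_add_of_nonneg_left (sq_nonneg _))

theorem summable_inv_one_add_mul_sq {c : ℝ} (hc : 0 < c) :
    Summable fun x : ℤ => (1 + c * (x : ℝ) ^ 2)⁻¹ := by
  have h : Summable fun x : ℤ => c⁻¹ * (1 / (x : ℝ) ^ 2) :=
    (Real.summable_one_div_int_pow.mpr one_lt_two).mul_left _
  refine h.of_norm_bounded_eventually ?_
  rw [Filter.eventually_cofinite]
  -- Comparison with `c⁻¹ / x²` fails only at `x = 0`, where the right side is `0` by convention.
  refine (Set.finite_singleton (0 : ℤ)).subset fun x hx => ?_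
  by_contra hx0
  refine hx ?_
  have hx0 : (x : ℝ) ≠ 0 := by exact_mod_cast hx0
  have hx2 : 0 < (x : ℝ) ^ 2 := by positivity
  rw [Real.norm_of_nonneg (by positivity), one_div, ← mul_inv]
  exact inv_anti₀ (by positivity) (by linarith)

theorem summable_lattice_weight {c : ℝ} (hc : 0 < c) :
    Summable fun s : ℤ × ℤ => ((1 + c * (s.1 : ℝ) ^ 2) * (1 + (s.2 : ℝ) ^ 2))⁻¹ := by
  have h := (summable_inv_one_add_mul_sq hc).mul_of_nonneg
    (summable_inv_one_add_mul_sq one_pos) (fun x => by positivity) (fun x => by positivity)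
  simpa [mul_inv, mul_comm] using h

section Decay

variable {n : ℕ}

/-- Since `(1 + d)^p ≤ 2^p (1 + d^p)`, the decay bounds for `μ = 0` and `μ = p` suffice. The factor
`1 + d` also controls the diagonal. -/
theorem RapidDecay.exists_norm_coeff_le {H : LatticeSpace n →L[ℂ] LatticeSpace n}
    (hH : RapidDecay H) (p : ℕ) :
    ∃ C, 0 ≤ C ∧ ∀ i j, (1 + latticeDist i j) ^ p * ‖coeff H i j‖ ≤ C := by
  obtain ⟨C0, h0⟩ := hH 0 le_rfl
  obtain ⟨C1, h1⟩ := hH p (Nat.cast_nonneg p)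
  have h0 : ∀ i j, ‖coeff H i j‖ ≤ C0 := fun i j => by
    simpa using h0 (Set.mem_range_self (i, j))
  have h1 : ∀ i j, ‖coeff H i j‖ * latticeDist i j ^ p ≤ C1 := fun i j => by
    simpa using h1 (Set.mem_range_self (i, j))
  have key : ∀ i j, (1 + latticeDist i j) ^ p * ‖coeff H i j‖ ≤ 2 ^ p * (C0 + C1) := by
    intro i j
    have hd := latticeDist_nonneg i j
    have hp : (1 + latticeDist i j) ^ p ≤ 2 ^ p * (1 + latticeDist i j ^ p) := by
      rcases le_total (latticeDist i j) 1 with h | h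
      · calc (1 + latticeDist i j) ^ p ≤ 2 ^ p := by gcongr; linarith
          _ ≤ 2 ^ p * (1 + latticeDist i j ^ p) :=
            le_mul_of_one_le_right (by positivity) (by linarith [pow_nonneg hd p])
      · calc (1 + latticeDist i j) ^ p ≤ (2 * latticeDist i j) ^ p := by gcongr; linarith
          _ = 2 ^ p * latticeDist i j ^ p := mul_pow _ _ _
          _ ≤ 2 ^ p * (1 + latticeDist i j ^ p) := by gcongr; linarith
    calc (1 + latticeDist i j) ^ p * ‖coeff H i j‖
        ≤ 2 ^ p * (1 + latticeDist i j ^ p) * ‖coeff H i j‖ := by gcongr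
      _ = 2 ^ p * (‖coeff H i j‖ + ‖coeff H i j‖ * latticeDist i j ^ p) := by ring
      _ ≤ 2 ^ p * (C0 + C1) := by gcongr; exacts [h0 i j, h1 i j]
  exact ⟨_, (by have := latticeDist_nonneg 0 0; positivity : (0 : ℝ) ≤ _).trans (key 0 0), key⟩

/-- Operators whose coefficients are dominated by those of `H`, up to a fourth power of the
distance, are bounded with a uniform constant. -/
theorem RapidDecay.exists_opNorm_le {H : LatticeSpace n →L[ℂ] LatticeSpace n}
    (hH : RapidDecay H) : ∃ S, 0 ≤ S ∧ ∀ (A : LatticeSpace n →L[ℂ] LatticeSpace n) (c : ℝ),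
      (∀ i j, ‖coeff A i j‖ ≤ c * ((1 + latticeDist i j) ^ 4 * ‖coeff H i j‖)) → 0 ≤ c →
        ‖A‖ ≤ c * S := by
  obtain ⟨C, hC0, hC⟩ := hH.exists_norm_coeff_le 8
  set k : ℤ × ℤ → ℝ := fun s => C * ((1 + 1 * (s.1 : ℝ) ^ 2) * (1 + (s.2 : ℝ) ^ 2))⁻¹ with hkdef
  have hk : Summable k := (summable_lattice_weight one_pos).mul_left C
  refine ⟨∑' s, k s, tsum_nonneg fun s => by positivity, fun A c hA hc => ?_⟩
  rw [← tsum_mul_left]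
  refine opNorm_le_of_coeff_le (hk.mul_left c) fun i j => (hA i j).trans ?_
  gcongr
  have hd := latticeDist_nonneg i j
  have hx := sq_le_sq' (by linarith [abs_nonneg ((i.1 : ℝ) - j.1)]) (abs_fst_sub_le_latticeDist i j)
  have hy := sq_le_sq' (by linarith [abs_nonneg ((i.2 : ℝ) - j.2)]) (abs_snd_sub_le_latticeDist i j)
  rw [sq_abs] at hx hy
  simp only [hkdef, Prod.fst_sub, Prod.snd_sub, Int.cast_sub]
  rw [← div_eq_mul_inv, le_div_iff₀ (by positivity)]
  calc (1 + latticeDist i j) ^ 4 * ‖coeff H i j‖ *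
        ((1 + 1 * ((i.1 : ℝ) - j.1) ^ 2) * (1 + ((i.2 : ℝ) - j.2) ^ 2))
      ≤ (1 + latticeDist i j) ^ 4 * ‖coeff H i j‖ *
        ((1 + latticeDist i j) ^ 2 * (1 + latticeDist i j) ^ 2) := by
        gcongr <;> nlinarith
    _ = (1 + latticeDist i j) ^ 8 * ‖coeff H i j‖ := by ring
    _ ≤ C := hC i j

end Decay

/-! ### Truncated polynomial weights -/

/-- The weight `1 + (κ min(|t|, N))²`. -/
noncomputable def weight (κ N t : ℝ) : ℝ := 1 + (κ * min |t| N) ^ 2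

theorem one_le_weight (κ N t : ℝ) : 1 ≤ weight κ N t :=
  le_add_of_nonneg_right (sq_nonneg _)

theorem weight_pos (κ N t : ℝ) : 0 < weight κ N t := one_pos.trans_le (one_le_weight κ N t)

theorem weight_eq {κ N t : ℝ} (h : |t| ≤ N) : weight κ N t = 1 + κ ^ 2 * t ^ 2 := by
  rw [weight, min_eq_left h, mul_pow, sq_abs]

theorem weight_le_one_add_sq {κ N t d : ℝ} (hN : 0 ≤ N) (hκ0 : 0 ≤ κ) (hκ1 : κ ≤ 1)
    (h : |t| ≤ d) : weight κ N t ≤ 1 + d ^ 2 := by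
  have h0 : 0 ≤ min |t| N := le_min (abs_nonneg t) hN
  have h1 : κ * min |t| N ≤ d :=
    (mul_le_of_le_one_left h0 hκ1).trans ((min_le_left _ _).trans h)
  rw [weight]
  gcongr

theorem bounded_weight (κ : ℝ) {N : ℝ} (hN : 0 ≤ N) (g : ℤ × ℤ → ℝ) :
    ∃ B, ∀ i, |weight κ N (g i)| ≤ B := by
  refine ⟨1 + (κ * N) ^ 2, fun i => ?_⟩
  have h0 : 0 ≤ min |g i| N := le_min (abs_nonneg _) hN
  rw [abs_of_pos (weight_pos _ _ _), weight, mul_pow, mul_pow]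
  gcongr
  exact min_le_right _ _

theorem bounded_inv_weight (κ N : ℝ) (g : ℤ × ℤ → ℝ) :
    ∃ B, ∀ i, |(weight κ N (g i))⁻¹| ≤ B :=
  ⟨1, fun i => by
    rw [abs_of_pos (inv_pos.mpr (weight_pos _ _ _))]
    exact inv_le_one_of_one_le₀ (one_le_weight _ _ _)⟩

/-- Truncation is 1-Lipschitz, so the difference of squares is at most `κ² d (2p + d)`, and `2κp ≤ 1
+ (κp)²` turns this into a multiple of the weight. One factor `κ` survives, and the bound does not
depend on `N`. -/
theorem abs_weight_sub_weight_le {κ N s t d : ℝ} (hN : 0 ≤ N) (hκ0 : 0 ≤ κ) (hκ1 : κ ≤ 1)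
    (h : |s - t| ≤ d) : |weight κ N t - weight κ N s| ≤ κ * (d + d ^ 2) * weight κ N s := by
  have hs0 : 0 ≤ min |s| N := le_min (abs_nonneg _) hN
  have ht0 : 0 ≤ min |t| N := le_min (abs_nonneg _) hN
  have hd0 : 0 ≤ d := (abs_nonneg _).trans h
  have hdiff : |min |t| N - min |s| N| ≤ d := by
    refine (abs_min_sub_min_le_max |t| N |s| N).trans ?_
    rw [sub_self, abs_zero]
    refine max_le ((abs_abs_sub_abs_le_abs_sub t s).trans ?_) hd0
    rwa [abs_sub_comm]
  rw [weight, weight]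
  set p := min |s| N
  set q := min |t| N
  have hsum : q + p ≤ 2 * p + d := by linarith [le_abs_self (q - p)]
  have hw : 2 * (κ * p) ≤ 1 + (κ * p) ^ 2 := by nlinarith [sq_nonneg (κ * p - 1)]
  have hw1 : 1 ≤ 1 + (κ * p) ^ 2 := le_add_of_nonneg_right (sq_nonneg _)
  calc |1 + (κ * q) ^ 2 - (1 + (κ * p) ^ 2)| = κ ^ 2 * (|q - p| * (q + p)) := by
        rw [show 1 + (κ * q) ^ 2 - (1 + (κ * p) ^ 2) = κ ^ 2 * ((q - p) * (q + p)) by ring,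
          abs_mul, abs_mul, abs_of_nonneg (add_nonneg ht0 hs0), abs_of_nonneg (sq_nonneg κ)]
    _ ≤ κ ^ 2 * (d * (2 * p + d)) := by gcongr
    _ = κ * (d * (2 * (κ * p)) + κ * d ^ 2) := by ring
    _ ≤ κ * (d * (1 + (κ * p) ^ 2) + 1 * d ^ 2 * (1 + (κ * p) ^ 2)) := by
        have hle : κ * d ^ 2 ≤ 1 * d ^ 2 * (1 + (κ * p) ^ 2) :=
          (mul_le_mul_of_nonneg_right hκ1 (sq_nonneg d)).trans
            (le_mul_of_one_le_right (by positivity) hw1)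
        gcongr
    _ = κ * (d + d ^ 2) * (1 + (κ * p) ^ 2) := by ring

/-! ### Conjugation by weights -/

section Conjugation

variable {n : ℕ}

/-- Multiplication by the weight in the first coordinate. -/
noncomputable def weightX (κ : ℝ) {N : ℝ} (hN : 0 ≤ N) : LatticeSpace n →L[ℂ] LatticeSpace n :=
  mulOp (fun i => weight κ N i.1) (bounded_weight κ hN _)

/-- Multiplication by the inverse weight in the first coordinate. -/
noncomputable def weightXInv (κ N : ℝ) : LatticeSpace n →L[ℂ] LatticeSpace n :=
  mulOp (fun i => (weight κ N i.1)⁻¹) (bounded_inv_weight κ N _)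

/-- Multiplication by the weight in the second coordinate. -/
noncomputable def weightY {N : ℝ} (hN : 0 ≤ N) : LatticeSpace n →L[ℂ] LatticeSpace n :=
  mulOp (fun i => weight 1 N i.2) (bounded_weight 1 hN _)

theorem weightX_mul_weightXInv (κ : ℝ) {N : ℝ} (hN : 0 ≤ N) :
    (weightX κ hN * weightXInv κ N : LatticeSpace n →L[ℂ] LatticeSpace n) = 1 :=
  mulOp_mul_mulOp_eq_one _ _ fun _ => mul_inv_cancel₀ (weight_pos _ _ _).ne'

theorem weightXInv_mul_weightX (κ : ℝ) {N : ℝ} (hN : 0 ≤ N) :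
    (weightXInv κ N * weightX κ hN : LatticeSpace n →L[ℂ] LatticeSpace n) = 1 :=
  mulOp_mul_mulOp_eq_one _ _ fun _ => inv_mul_cancel₀ (weight_pos _ _ _).ne'

theorem weightX_mul_weightY_delta {κ N : ℝ} (hN : 0 ≤ N) {j : ℤ × ℤ} (h1 : |(j.1 : ℝ)| ≤ N)
    (h2 : |(j.2 : ℝ)| ≤ N) (v : EuclideanSpace ℂ (Fin n)) :
    weightX κ hN (weightY hN (delta j v)) =
      (((1 + κ ^ 2 * (j.1 : ℝ) ^ 2) * (1 + (j.2 : ℝ) ^ 2) : ℝ) : ℂ) • delta j v := by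
  rw [weightX, weightY, mulOp_delta, map_smul, mulOp_delta, smul_smul, ← Complex.ofReal_mul,
    weight_eq h1, weight_eq h2, one_pow, one_mul, mul_comm]

variable {H : LatticeSpace n →L[ℂ] LatticeSpace n} {κ N : ℝ}

/-- Conjugation multiplies `H_{ij}` by `w_j / w_i = 1 + (w_j - w_i) / w_i`, and the slow variation
of the weight makes the correction `O(κ)`, uniformly in `N`. -/
theorem norm_coeff_conj_sub_le (hN : 0 ≤ N) (hκ0 : 0 ≤ κ) (hκ1 : κ ≤ 1) (i j : ℤ × ℤ) :
    ‖coeff (weightXInv κ N * H * weightX κ hN - H) i j‖ ≤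
      κ * ((1 + latticeDist i j) ^ 4 * ‖coeff H i j‖) := by
  have hd := latticeDist_nonneg i j
  have hw := weight_pos κ N i.1
  rw [coeff_sub, weightX, coeff_mul_mulOp, weightXInv, coeff_mulOp_mul, smul_smul]
  have : ((weight κ N j.1 : ℝ) : ℂ) * (((weight κ N i.1)⁻¹ : ℝ) : ℂ) =
      1 + (((weight κ N j.1 - weight κ N i.1) / weight κ N i.1 : ℝ) : ℂ) := by
    rw [← Complex.ofReal_mul, ← Complex.ofReal_one, ← Complex.ofReal_add]
    congr 1
    field_simp
    ring
  have hsub : ∀ (c : ℂ) (A : EuclideanSpace ℂ (Fin n) →L[ℂ] EuclideanSpace ℂ (Fin n)),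
      (1 + c) • A - A = c • A := fun c A => by module
  rw [this, hsub, norm_smul, Complex.norm_real,
    Real.norm_eq_abs, abs_div, abs_of_pos hw, ← mul_assoc]
  gcongr
  rw [div_le_iff₀ hw]
  refine (abs_weight_sub_weight_le hN hκ0 hκ1 (abs_fst_sub_le_latticeDist i j)).trans ?_
  gcongr
  nlinarith [pow_nonneg hd 2, pow_nonneg hd 3, pow_nonneg hd 4]

/-- A nonzero coefficient jumps from `j ∉ Y` to `i ∈ Y`, so `|j.1| ≤ d(i, j)` and the decay of `H`
absorbs the whole weight. -/
theorem norm_coeff_boundary_le (hN : 0 ≤ N) (hκ0 : 0 ≤ κ) (hκ1 : κ ≤ 1) (i j : ℤ × ℤ) :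
    ‖coeff (chi halfY * H * chi halfYᶜ * weightX κ hN) i j‖ ≤
      1 * ((1 + latticeDist i j) ^ 4 * ‖coeff H i j‖) := by
  classical
  have hd := latticeDist_nonneg i j
  rw [weightX, coeff_mul_mulOp, coeff_mul_chi, coeff_chi_mul, one_mul, norm_smul, Complex.norm_real,
    Real.norm_of_nonneg (weight_pos _ _ _).le]
  split_ifs with hj hi
  · gcongr
    have hi : (0 : ℝ) ≤ i.1 := by exact_mod_cast hi
    have hj : (j.1 : ℝ) < 0 := by exact_mod_cast not_le.mp (show ¬ 0 ≤ j.1 from hj)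
    have hle : |(j.1 : ℝ)| ≤ latticeDist i j := by
      refine le_trans ?_ (abs_fst_sub_le_latticeDist i j)
      rw [abs_of_neg hj, abs_of_nonneg] <;> linarith
    refine (weight_le_one_add_sq hN hκ0 hκ1 hle).trans ?_
    nlinarith [pow_nonneg hd 2, pow_nonneg hd 3, pow_nonneg hd 4]
  all_goals
    rw [norm_zero, mul_zero]
    positivity

/-- The commutator only connects sites on opposite sides of `y = 0`, whence `|j.2| ≤ d(i, j)` and
the `y`-weight costs `(1 + d)²`. The `x`-weights enter as a ratio, costing another `(1 + d)²`. -/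
theorem norm_coeff_commutator_le (hN : 0 ≤ N) (hκ0 : 0 ≤ κ) (hκ1 : κ ≤ 1) (i j : ℤ × ℤ) :
    ‖coeff (weightXInv κ N * ⁅contraction halfY H, (chi halfW : LatticeSpace n →L[ℂ] _)⁆ *
        weightX κ hN * weightY hN) i j‖ ≤
      1 * ((1 + latticeDist i j) ^ 4 * ‖coeff H i j‖) := by
  classical
  have hd := latticeDist_nonneg i j
  have hw := weight_pos κ N i.1
  rw [weightX, weightY, weightXInv, coeff_mul_mulOp, coeff_mul_mulOp, coeff_mulOp_mul,
    Ring.lie_def, coeff_sub, coeff_mul_chi, coeff_chi_mul, smul_smul, smul_smul, norm_smul,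
    one_mul, ← Complex.ofReal_mul, ← Complex.ofReal_mul, Complex.norm_real, Real.norm_of_nonneg
      (mul_nonneg (mul_nonneg (weight_pos _ _ _).le (weight_pos _ _ _).le)
        (inv_nonneg.mpr (weight_pos _ _ _).le))]
  have hcontr : ‖coeff (contraction halfY H) i j‖ ≤ ‖coeff H i j‖ := by
    rw [contraction, coeff_mul_chi, coeff_chi_mul]
    split_ifs <;> simp
  have hx : weight κ N j.1 ≤ (1 + latticeDist i j) ^ 2 * weight κ N i.1 := by
    have h := (abs_le.mp (abs_weight_sub_weight_le hN hκ0 hκ1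
      (abs_fst_sub_le_latticeDist i j))).2
    have h' : κ * (latticeDist i j + latticeDist i j ^ 2) * weight κ N i.1 ≤
        1 * (latticeDist i j + latticeDist i j ^ 2) * weight κ N i.1 := by gcongr
    nlinarith [mul_nonneg hd hw.le]
  have hy : |(j.2 : ℝ)| ≤ latticeDist i j →
      weight 1 N j.2 * weight κ N j.1 * (weight κ N i.1)⁻¹ ≤ (1 + latticeDist i j) ^ 4 := by
    intro h
    have h1 : weight 1 N j.2 ≤ (1 + latticeDist i j) ^ 2 :=
      (weight_le_one_add_sq hN zero_le_one le_rfl h).trans (by nlinarith)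
    rw [← div_eq_mul_inv, div_le_iff₀ hw]
    calc weight 1 N j.2 * weight κ N j.1
        ≤ (1 + latticeDist i j) ^ 2 * ((1 + latticeDist i j) ^ 2 * weight κ N i.1) :=
          mul_le_mul h1 hx (weight_pos _ _ _).le (by positivity)
      _ = (1 + latticeDist i j) ^ 4 * weight κ N i.1 := by ring
  have hle := abs_snd_sub_le_latticeDist i j
  split_ifs with hj hi hi
  · rw [sub_self, norm_zero, mul_zero]
    positivity
  · have hi : (i.2 : ℝ) < 0 := by exact_mod_cast not_le.mp hi
    have hj : (0 : ℝ) ≤ j.2 := by exact_mod_cast hj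
    rw [sub_zero]
    refine mul_le_mul (hy ?_) hcontr (norm_nonneg _) (by positivity)
    rw [abs_of_neg (by linarith)] at hle
    rw [abs_of_nonneg hj]
    linarith
  · have hi : (0 : ℝ) ≤ i.2 := by exact_mod_cast hi
    have hj : (j.2 : ℝ) < 0 := by exact_mod_cast not_le.mp hj
    rw [zero_sub, norm_neg]
    refine mul_le_mul (hy ?_) hcontr (norm_nonneg _) (by positivity)
    rw [abs_of_nonneg (by linarith)] at hle
    rw [abs_of_neg hj]
    linarith
  · rw [sub_self, norm_zero, mul_zero]
    positivity

/-- A perturbation bound for inverses. -/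
theorem norm_inverse_perturb_le {A : Type*} [NormedRing A] {L L' R R' : A} {r ε : ℝ}
    (hr : 0 < r) (hε : ε < r) (hRL : R * L = 1) (hLR' : L' * R' = 1) (hR : ‖R‖ ≤ r⁻¹)
    (hL : ‖L' - L‖ ≤ ε) : ‖R'‖ ≤ (r - ε)⁻¹ := by
  -- The second resolvent identity, needing only a left inverse of `L` and a right inverse of `L'`.
  have hR' : R' = R - R * (L' - L) * R' := by
    rw [mul_sub, sub_mul, mul_assoc, hLR', hRL, mul_one, one_mul, sub_sub_cancel]
  have h : ‖R'‖ ≤ r⁻¹ + r⁻¹ * ε * ‖R'‖ := by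
    calc ‖R'‖ = ‖R - R * (L' - L) * R'‖ := by rw [← hR']
      _ ≤ ‖R‖ + ‖R‖ * ‖L' - L‖ * ‖R'‖ := by
        refine (norm_sub_le _ _).trans ?_
        gcongr
        exact (norm_mul_le _ _).trans (by gcongr; exact norm_mul_le _ _)
      _ ≤ r⁻¹ + r⁻¹ * ε * ‖R'‖ := by gcongr
  rw [← one_div, le_div_iff₀ (by linarith)]
  have h2 := mul_le_mul_of_nonneg_left h hr.le
  have h3 : r * (r⁻¹ + r⁻¹ * ε * ‖R'‖) = 1 + ε * ‖R'‖ := by field_simp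
  rw [h3] at h2
  linarith

theorem norm_mul_pow_le {A : Type*} [NormedRing A] {x y : A} {a b : ℝ} (hx : ‖x‖ ≤ a)
    (hy : ‖y‖ ≤ b) (m : ℕ) : ‖x * y ^ m‖ ≤ a * b ^ m := by
  have ha : 0 ≤ a := (norm_nonneg _).trans hx
  have hb : 0 ≤ b := (norm_nonneg _).trans hy
  induction m with
  | zero => simpa using hx
  | succ m ih =>
    rw [pow_succ, pow_succ, ← mul_assoc, ← mul_assoc]
    exact (norm_mul_le _ _).trans (mul_le_mul ih hy (norm_nonneg _) (by positivity))

/-- The vectors `K (χ_Y R χ_Y)^m C δ_j`, with `K = χ_Y H χ_{Yᶜ} R χ_Y` and `C = [χ_Y H χ_Y, χ_W]`,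
grow at a rate close to `r⁻¹` in `m` and decay in `j`. -/
theorem exists_norm_boundary_pow_commutator_le (hdecay : RapidDecay H)
    {R : LatticeSpace n →L[ℂ] LatticeSpace n} {z r r' : ℝ} (hr' : 0 ≤ r') (hr : r' < r)
    (hRL : R * (H - algebraMap ℝ _ z) = 1) (hLR : (H - algebraMap ℝ _ z) * R = 1)
    (hR : ‖R‖ ≤ r⁻¹) :
    ∃ κ c ρ : ℝ, 0 < κ ∧ 0 ≤ c ∧ 0 ≤ ρ ∧ r' * ρ < 1 ∧
      ∀ (m : ℕ) (j : ℤ × ℤ) (v : EuclideanSpace ℂ (Fin n)),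
        ‖((chi halfY * H * chi halfYᶜ * R * chi halfY) * (chi halfY * R * chi halfY) ^ m *
            ⁅contraction halfY H, (chi halfW : LatticeSpace n →L[ℂ] _)⁆ :
              LatticeSpace n →L[ℂ] LatticeSpace n) (delta j v)‖ ≤
          c * ρ ^ m * (((1 + κ ^ 2 * (j.1 : ℝ) ^ 2) * (1 + (j.2 : ℝ) ^ 2))⁻¹ * ‖v‖) := by
  obtain ⟨S, hS0, hS⟩ := hdecay.exists_opNorm_le
  have hr0 : 0 < r := hr'.trans_lt hr
  obtain ⟨κ, hκ0, hκ1, hκS⟩ : ∃ κ : ℝ, 0 < κ ∧ κ ≤ 1 ∧ κ * S < r - r' := by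
    -- This forces `r' < r - κS`, the condition for convergence with `ρ = (r - κS)⁻¹`; `S + 1`
    -- covers `S = 0` and gives strictness.
    refine ⟨min 1 ((r - r') / (S + 1)), lt_min one_pos (div_pos (by linarith) (by linarith)),
      min_le_left _ _, ?_⟩
    calc min 1 ((r - r') / (S + 1)) * S ≤ (r - r') / (S + 1) * S := by
          gcongr
          exact min_le_right _ _
      _ < r - r' := by
          rw [div_mul_eq_mul_div, div_lt_iff₀ (by linarith)]
          nlinarith
  have hgap : 0 < r - κ * S := by linarith
  refine ⟨κ, S * (r - κ * S)⁻¹ * S, (r - κ * S)⁻¹, hκ0, by positivity, by positivity, ?_,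
    fun m j v => ?_⟩
  · rw [← div_eq_mul_inv, div_lt_one hgap]
    linarith
  -- The truncation keeps the weights bounded operators yet is inactive at `j`; it may depend on `j`
  -- because all estimates are uniform in `N`.
  set N : ℝ := max |(j.1 : ℝ)| |(j.2 : ℝ)|
  have hN : 0 ≤ N := (abs_nonneg _).trans (le_max_left _ _)
  set D : ℝ := (1 + κ ^ 2 * (j.1 : ℝ) ^ 2) * (1 + (j.2 : ℝ) ^ 2) with hD
  have hD0 : 0 < D := by positivity
  set C := ⁅contraction halfY H, (chi halfW : LatticeSpace n →L[ℂ] LatticeSpace n)⁆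
  set Y : LatticeSpace n →L[ℂ] LatticeSpace n := chi halfY
  set Y' : LatticeSpace n →L[ℂ] LatticeSpace n := chi halfYᶜ
  set W : LatticeSpace n →L[ℂ] LatticeSpace n := weightX κ hN
  set W' : LatticeSpace n →L[ℂ] LatticeSpace n := weightXInv κ N
  set V : LatticeSpace n →L[ℂ] LatticeSpace n := weightY hN
  have hWW' : W * W' = 1 := weightX_mul_weightXInv κ hN
  have hW'W : W' * W = 1 := weightXInv_mul_weightX κ hN
  have hWY : W * Y = Y * W := commute_mulOp_chi _ _ _
  have hW'Y : W' * Y = Y * W' := commute_mulOp_chi _ _ _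
  have hY1 : ‖Y‖ ≤ 1 := norm_chi_le _
  set Rw := W' * R * W with hRw
  have hRw_norm : ‖Rw‖ ≤ (r - κ * S)⁻¹ := by
    have hz : algebraMap ℝ (LatticeSpace n →L[ℂ] LatticeSpace n) z * W =
        W * algebraMap ℝ (LatticeSpace n →L[ℂ] LatticeSpace n) z := Algebra.commutes z W
    refine norm_inverse_perturb_le (L := H - algebraMap ℝ _ z)
      (L' := W' * (H - algebraMap ℝ _ z) * W) hr0 (by linarith) hRL ?_ hR ?_
    · calc W' * (H - algebraMap ℝ _ z) * W * Rw
          = W' * (H - algebraMap ℝ _ z) * (W * W') * R * W := by simp only [hRw, mul_assoc]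
        _ = W' * ((H - algebraMap ℝ _ z) * R) * W := by rw [hWW', mul_one, mul_assoc W']
        _ = 1 := by rw [hLR, mul_one, hW'W]
    · have : W' * (H - algebraMap ℝ _ z) * W - (H - algebraMap ℝ _ z) = W' * H * W - H := by
        rw [mul_sub, sub_mul, mul_assoc W' (algebraMap ℝ _ z), hz, ← mul_assoc W' W, hW'W,
          one_mul]
        abel
      rw [this]
      exact hS _ κ (norm_coeff_conj_sub_le hN hκ0.le hκ1) hκ0.le
  set Q := Y * Rw * Y with hQ
  have hQ_norm : ‖Q‖ ≤ (r - κ * S)⁻¹ := by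
    calc ‖Q‖ ≤ ‖Y‖ * ‖Rw‖ * ‖Y‖ :=
          (norm_mul_le _ _).trans (by gcongr; exact norm_mul_le _ _)
      _ ≤ 1 * (r - κ * S)⁻¹ * 1 := by gcongr
      _ = (r - κ * S)⁻¹ := by ring
  have hsemi : SemiconjBy W Q (Y * R * Y) := by
    change W * Q = Y * R * Y * W
    calc W * Q = (W * Y) * W' * R * (W * Y) := by simp only [hQ, hRw, mul_assoc]
      _ = Y * (W * W') * R * (Y * W) := by rw [hWY]; simp only [mul_assoc]
      _ = Y * R * Y * W := by rw [hWW']; simp only [mul_assoc, mul_one]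
  have hpow : W * Q ^ m = (Y * R * Y) ^ m * W := hsemi.pow_right m
  -- Insert `W W' = 1` before `C` and move `W` left through the powers, which become `Q ^ m`, and
  -- through `R`, up to the boundary factor.
  have hfac : (Y * H * Y' * R * Y) * (Y * R * Y) ^ m * C * (W * V) =
      (Y * H * Y' * W) * Rw * Y * Q ^ m * (W' * C * W * V) := by
    calc (Y * H * Y' * R * Y) * (Y * R * Y) ^ m * C * (W * V)
        = (Y * H * Y' * R * Y) * (Y * R * Y) ^ m * (W * W') * C * (W * V) := by
          rw [hWW', mul_one]
      _ = (Y * H * Y' * R * Y) * ((Y * R * Y) ^ m * W) * (W' * C * W * V) := by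
          simp only [mul_assoc]
      _ = Y * H * Y' * (W * W') * R * (Y * W) * Q ^ m * (W' * C * W * V) := by
          rw [← hpow, hWW', mul_one]; simp only [mul_assoc]
      _ = (Y * H * Y' * W) * Rw * Y * Q ^ m * (W' * C * W * V) := by
          rw [← hWY, hRw]; simp only [mul_assoc]
  have hnorm : ‖(Y * H * Y' * W) * Rw * Y * Q ^ m * (W' * C * W * V)‖ ≤
      S * (r - κ * S)⁻¹ * S * (r - κ * S)⁻¹ ^ m := by
    have hA : ‖Y * H * Y' * W‖ ≤ S := by
      simpa using hS _ 1 (norm_coeff_boundary_le hN hκ0.le hκ1) zero_le_one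
    have hB : ‖W' * C * W * V‖ ≤ S := by
      simpa using hS _ 1 (norm_coeff_commutator_le hN hκ0.le hκ1) zero_le_one
    have hQm : ‖(Y * H * Y' * W) * Rw * Y * Q ^ m‖ ≤
        S * (r - κ * S)⁻¹ * (r - κ * S)⁻¹ ^ m := by
      have hAY : ‖(Y * H * Y' * W) * Rw * Y‖ ≤ S * (r - κ * S)⁻¹ := by
        calc ‖(Y * H * Y' * W) * Rw * Y‖ ≤ ‖Y * H * Y' * W‖ * ‖Rw‖ * ‖Y‖ :=
              (norm_mul_le _ _).trans (by gcongr; exact norm_mul_le _ _)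
          _ ≤ S * (r - κ * S)⁻¹ * 1 := by gcongr
          _ = S * (r - κ * S)⁻¹ := mul_one _
      exact norm_mul_pow_le hAY hQ_norm m
    calc ‖(Y * H * Y' * W) * Rw * Y * Q ^ m * (W' * C * W * V)‖
        ≤ S * (r - κ * S)⁻¹ * (r - κ * S)⁻¹ ^ m * S :=
          (norm_mul_le _ _).trans (mul_le_mul hQm hB (norm_nonneg _) (by positivity))
      _ = S * (r - κ * S)⁻¹ * S * (r - κ * S)⁻¹ ^ m := by ring
  have hdelta : delta j v = ((D⁻¹ : ℝ) : ℂ) • (W * V) (delta j v) := by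
    have h : (W * V) (delta j v) = (D : ℂ) • delta j v :=
      weightX_mul_weightY_delta hN (le_max_left _ _) (le_max_right _ _) v
    rw [h, smul_smul, ← Complex.ofReal_mul, inv_mul_cancel₀ hD0.ne', Complex.ofReal_one, one_smul]
  rw [hdelta, map_smul, norm_smul, Complex.norm_real, Real.norm_of_nonneg (inv_nonneg.mpr hD0.le)]
  change D⁻¹ * ‖((Y * H * Y' * R * Y) * (Y * R * Y) ^ m * C * (W * V)) (delta j v)‖ ≤ _
  rw [hfac]
  calc D⁻¹ * ‖((Y * H * Y' * W) * Rw * Y * Q ^ m * (W' * C * W * V)) (delta j v)‖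
      ≤ D⁻¹ * (S * (r - κ * S)⁻¹ * S * (r - κ * S)⁻¹ ^ m * ‖v‖) := by
        gcongr
        refine (ContinuousLinearMap.le_opNorm _ _).trans ?_
        rw [norm_delta]
        gcongr
    _ = S * (r - κ * S)⁻¹ * S * (r - κ * S)⁻¹ ^ m * (D⁻¹ * ‖v‖) := by ring

end Conjugation

/-! ### The spectral gap and the functional calculus of the contraction -/

section Gap

/-- In a gap of radius `r` around `z`, a self-adjoint operator has a resolvent of norm at most
`r⁻¹`. -/
theorem exists_resolvent_of_gap {A : Type*} [CStarAlgebra A] {H : A} (hH : IsSelfAdjoint H)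
    {z r : ℝ} (hr : 0 < r) (hgap : ∀ t ∈ spectrum ℝ H, r ≤ |t - z|) :
    ∃ R : A, R * (H - algebraMap ℝ A z) = 1 ∧ (H - algebraMap ℝ A z) * R = 1 ∧ ‖R‖ ≤ r⁻¹ := by
  have hne : ∀ t ∈ spectrum ℝ H, t - z ≠ 0 := fun t ht =>
    abs_pos.mp (hr.trans_le (hgap t ht))
  have hc : ContinuousOn (fun t : ℝ => (t - z)⁻¹) (spectrum ℝ H) :=
    (continuousOn_id.sub continuousOn_const).inv₀ hne
  have hL : H - algebraMap ℝ A z = cfc (fun t : ℝ => t - z) H := by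
    rw [cfc_sub (fun t : ℝ => t) (fun _ => z) H, cfc_id' ℝ H, cfc_const z H]
  refine ⟨cfc (fun t : ℝ => (t - z)⁻¹) H, ?_, ?_, norm_cfc_le (inv_nonneg.mpr hr.le) ?_⟩
  · rw [hL, ← cfc_mul _ _ H hc, ← cfc_one ℝ H]
    exact cfc_congr fun t ht => inv_mul_cancel₀ (hne t ht)
  · rw [hL, ← cfc_mul _ _ H (by fun_prop) hc, ← cfc_one ℝ H]
    exact cfc_congr fun t ht => mul_inv_cancel₀ (hne t ht)
  · intro t ht
    rw [norm_inv, Real.norm_eq_abs]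
    exact inv_anti₀ hr (hgap t ht)

/-- Peels off the factor `G - z` that the approximate inverse then cancels up to the boundary term.
-/
theorem cfc_mul_sub_pow_succ {A : Type*} [CStarAlgebra A] {G : A} (hG : IsSelfAdjoint G)
    {φ : ℝ → ℝ} (hφ : Continuous φ) (z : ℝ) (m : ℕ) :
    cfc (fun t => φ t * (t - z) ^ (m + 1)) G =
      cfc (fun t => φ t * (t - z) ^ m) G * (G - algebraMap ℝ A z) := by
  have hL : G - algebraMap ℝ A z = cfc (fun t : ℝ => t - z) G := by
    rw [cfc_sub (fun t : ℝ => t) (fun _ => z) G, cfc_id' ℝ G, cfc_const z G]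
  rw [hL, ← cfc_mul _ _ G]
  congr 1
  funext t
  ring

/-- Compactness gives the strict margin `r' < r`, which makes the remainder vanish and leaves room
for the weight. -/
theorem exists_radius_lt_of_tsupport_subset {φ : ℝ → ℝ} (hφ : HasCompactSupport φ)
    {z r : ℝ} (hr : 0 < r) (hsupp : tsupport φ ⊆ Set.Ioo (z - r) (z + r)) :
    ∃ r', 0 ≤ r' ∧ r' < r ∧ ∀ t, φ t ≠ 0 → |t - z| ≤ r' := by
  rcases (tsupport φ).eq_empty_or_nonempty with h | h
  · refine ⟨0, le_rfl, hr, fun t ht => ?_⟩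
    have := subset_tsupport φ (Function.mem_support.mpr ht)
    simp [h] at this
  · obtain ⟨x, hx, hmax⟩ := hφ.isCompact.exists_isMaxOn h
      (f := fun t => |t - z|) (by fun_prop)
    refine ⟨|x - z|, abs_nonneg _, ?_, fun t ht =>
      hmax (subset_tsupport φ (Function.mem_support.mpr ht))⟩
    have := hsupp hx
    rw [abs_lt]
    constructor <;> linarith [this.1, this.2]

variable {n : ℕ} {H R : LatticeSpace n →L[ℂ] LatticeSpace n} {z : ℝ}

/-- The compressed resolvent inverts `χ_Y H χ_Y - z` up to a boundary term. -/
theorem contraction_sub_mul_compress (Y : Set (ℤ × ℤ)) (hLR : (H - algebraMap ℝ _ z) * R = 1) :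
    (contraction Y H - algebraMap ℝ _ z) * (chi Y * R * chi Y) =
      chi Y - chi Y * H * chi Yᶜ * R * chi Y := by
  have hYY := chi_mul_chi_self (n := n) Y
  have hYY' := chi_mul_chi_compl (n := n) Y
  have hY' : (chi Y : LatticeSpace n →L[ℂ] _) = 1 - chi Yᶜ :=
    eq_sub_of_add_eq (chi_add_chi_compl Y)
  have hz := Algebra.commutes z (chi Y : LatticeSpace n →L[ℂ] LatticeSpace n)
  rw [contraction]
  generalize algebraMap ℝ (LatticeSpace n →L[ℂ] LatticeSpace n) z = ζ at hz hLR ⊢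
  generalize (chi Yᶜ : LatticeSpace n →L[ℂ] LatticeSpace n) = P' at hYY' hY' ⊢
  generalize (chi Y : LatticeSpace n →L[ℂ] LatticeSpace n) = P at *
  have hHR : H * R = 1 + ζ * R := by rw [← hLR]; noncomm_ring
  calc (P * H * P - ζ) * (P * R * P)
      = P * H * (P * P) * R * P - (ζ * P) * R * P := by noncomm_ring
    _ = P * H * P * R * P - P * ζ * R * P := by rw [hYY, hz]
    _ = P * (H * R) * P - P * H * P' * R * P - P * ζ * R * P := by
        -- Only the middle projection is replaced by `1 - P'`; this produces the boundary term.
        nth_rewrite 2 [hY']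
        noncomm_ring
    _ = P * P - P * H * P' * R * P := by rw [hHR]; noncomm_ring
    _ = P - P * H * P' * R * P := by rw [hYY]

/-- Iterating the parametrix identity. -/
theorem mul_eq_sum_add_of_recursion {A : Type*} [Ring A] {F : ℕ → A} {P Q K : A}
    (hPQ : P * Q = Q) (hF : ∀ m, F m * P = F (m + 1) * Q + F m * K) (M : ℕ) :
    F 0 * P = ∑ m ∈ Finset.range M, F m * (K * Q ^ m) + F M * P * Q ^ M := by
  induction M with
  | zero => simp
  | succ M ih =>
    rw [ih, Finset.sum_range_succ, hF M, pow_succ' Q, add_assoc, mul_assoc (F (M + 1)),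
      ← mul_assoc P Q, hPQ]
    noncomm_ring

/-- The norm estimate resulting from the iterated parametrix identity. -/
theorem norm_apply_le_of_parametrix {E : Type*} [NormedAddCommGroup E] [NormedSpace ℂ E]
    {F : ℕ → E →L[ℂ] E} {P Q K C : E →L[ℂ] E} {u : E} {B r r' c ρ D : ℝ} (hB0 : 0 ≤ B)
    (hr'0 : 0 ≤ r') (hc : 0 ≤ c) (hρ : 0 ≤ ρ) (hr'ρ : r' * ρ < 1) (hr : 0 < r) (hr'r : r' < r)
    (hD : 0 ≤ D) (hPQ : P * Q = Q) (hPC : P * C = C)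
    (hrec : ∀ m, F m * P = F (m + 1) * Q + F m * K) (hFnorm : ∀ m, ‖F m‖ ≤ B * r' ^ m)
    (hPnorm : ‖P‖ ≤ 1) (hQnorm : ‖Q‖ ≤ r⁻¹)
    (hest : ∀ m, ‖(K * Q ^ m * C) u‖ ≤ c * ρ ^ m * D) :
    ‖(F 0 * C) u‖ ≤ B * c * (1 - r' * ρ)⁻¹ * D := by
  have hq0 : 0 ≤ r' * ρ := mul_nonneg hr'0 hρ
  -- The remainder does not decay in `u`, but it vanishes as `M → ∞` for each fixed `u`, leaving
  -- only the `D` term.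
  have hbound : ∀ M : ℕ, ‖(F 0 * C) u‖ ≤
      B * c * (1 - r' * ρ)⁻¹ * D + B * (r' * r⁻¹) ^ M * ‖C u‖ := by
    intro M
    have hexp : F 0 * C =
        ∑ m ∈ Finset.range M, F m * (K * Q ^ m * C) + F M * P * Q ^ M * C := by
      rw [← hPC, ← mul_assoc, mul_eq_sum_add_of_recursion hPQ hrec M, add_mul,
        Finset.sum_mul, hPC]
      simp only [mul_assoc]
    have hterm : ∀ m, ‖(F m * (K * Q ^ m * C)) u‖ ≤ B * c * D * (r' * ρ) ^ m := fun m => by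
      calc ‖(F m * (K * Q ^ m * C)) u‖ ≤ ‖F m‖ * ‖(K * Q ^ m * C) u‖ :=
            (F m).le_opNorm ((K * Q ^ m * C) u)
        _ ≤ B * r' ^ m * (c * ρ ^ m * D) :=
            mul_le_mul (hFnorm m) (hest m) (norm_nonneg _) (by positivity)
        _ = B * c * D * (r' * ρ) ^ m := by rw [mul_pow]; ring
    have hrem : ‖(F M * P * Q ^ M * C) u‖ ≤ B * (r' * r⁻¹) ^ M * ‖C u‖ := by
      have hFP : ‖F M * P‖ ≤ B * r' ^ M :=
        (norm_mul_le _ _).trans ((mul_le_of_le_one_right (norm_nonneg _) hPnorm).trans (hFnorm M))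
      calc ‖(F M * P * Q ^ M * C) u‖ ≤ ‖F M * P * Q ^ M‖ * ‖C u‖ :=
            (F M * P * Q ^ M).le_opNorm (C u)
        _ ≤ B * r' ^ M * r⁻¹ ^ M * ‖C u‖ := by
            gcongr
            exact norm_mul_pow_le hFP hQnorm M
        _ = B * (r' * r⁻¹) ^ M * ‖C u‖ := by rw [mul_pow]; ring
    rw [hexp, add_apply, sum_apply]
    refine (norm_add_le _ _).trans (add_le_add ?_ hrem)
    calc ‖∑ m ∈ Finset.range M, (F m * (K * Q ^ m * C)) u‖
        ≤ ∑ m ∈ Finset.range M, B * c * D * (r' * ρ) ^ m :=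
          norm_sum_le_of_le _ fun m _ => hterm m
      _ = B * c * D * ∑ m ∈ Finset.range M, (r' * ρ) ^ m := by rw [Finset.mul_sum]
      _ ≤ B * c * D * (1 - r' * ρ)⁻¹ := by
          gcongr
          rw [← tsum_geometric_of_lt_one hq0 hr'ρ]
          exact (summable_geometric_of_lt_one hq0 hr'ρ).sum_le_tsum _ fun m _ => by positivity
      _ = B * c * (1 - r' * ρ)⁻¹ * D := by ring
  have hlim : Filter.Tendsto (fun M : ℕ =>
      B * c * (1 - r' * ρ)⁻¹ * D + B * (r' * r⁻¹) ^ M * ‖C u‖) Filter.atTop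
      (nhds (B * c * (1 - r' * ρ)⁻¹ * D + B * 0 * ‖C u‖)) := by
    have hq : r' * r⁻¹ < 1 := by rwa [← div_eq_mul_inv, div_lt_one hr]
    exact (((tendsto_pow_atTop_nhds_zero_of_lt_one (by positivity) hq).const_mul B).mul_const
      _).const_add _
  rw [mul_zero, zero_mul, add_zero] at hlim
  exact ge_of_tendsto' hlim hbound

/-- This inserts the projection `χ_Y` to the right of `φ(H̃)`, where the iterated expansion applies.
-/
theorem chi_mul_commutator (Y W : Set (ℤ × ℤ)) (H : LatticeSpace n →L[ℂ] LatticeSpace n) :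
    chi Y * ⁅contraction Y H, (chi W : LatticeSpace n →L[ℂ] LatticeSpace n)⁆ =
      ⁅contraction Y H, (chi W : LatticeSpace n →L[ℂ] LatticeSpace n)⁆ := by
  have hY : chi Y * contraction Y H = contraction Y H := by
    rw [contraction, ← mul_assoc, ← mul_assoc, chi_mul_chi_self]
  rw [Ring.lie_def, mul_sub, ← mul_assoc, hY, ← mul_assoc, (commute_chi_chi Y W).eq, mul_assoc, hY]

end Gap

/-- The column norms of `φ(H̃) [H̃, χ_W]` are dominated by a summable function of the site. -/
theorem exists_norm_cfc_mul_commutator_delta_le {n : ℕ}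
    {H : LatticeSpace n →L[ℂ] LatticeSpace n} (hH : IsSelfAdjoint H) (hdecay : RapidDecay H)
    {z r : ℝ} (hr : 0 < r) (hgap : ∀ t ∈ spectrum ℝ H, r ≤ |t - z|) {φ : ℝ → ℝ}
    (hφ : Continuous φ) (hφ_compact : HasCompactSupport φ)
    (hφ_supp : tsupport φ ⊆ Set.Ioo (z - r) (z + r)) :
    ∃ κ c : ℝ, 0 < κ ∧ ∀ (j : ℤ × ℤ) (v : EuclideanSpace ℂ (Fin n)),
      ‖(cfc φ (contraction halfY H) *
          ⁅contraction halfY H, (chi halfW : LatticeSpace n →L[ℂ] _)⁆ :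
            LatticeSpace n →L[ℂ] LatticeSpace n) (delta j v)‖ ≤
        c * (((1 + κ ^ 2 * (j.1 : ℝ) ^ 2) * (1 + (j.2 : ℝ) ^ 2))⁻¹ * ‖v‖) := by
  obtain ⟨R, hRL, hLR, hR⟩ := exists_resolvent_of_gap hH hr hgap
  obtain ⟨r', hr'0, hr'r, hr'⟩ := exists_radius_lt_of_tsupport_subset hφ_compact hr hφ_supp
  obtain ⟨B, hB⟩ := hφ_compact.exists_bound_of_continuous hφ
  have hB0 : 0 ≤ B := (norm_nonneg _).trans (hB 0)
  obtain ⟨κ, c, ρ, hκ, hc, hρ, hr'ρ, hest⟩ :=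
    exists_norm_boundary_pow_commutator_le hdecay hr'0 hr'r hRL hLR hR
  refine ⟨κ, B * c * (1 - r' * ρ)⁻¹, hκ, fun j v => ?_⟩
  set G := contraction halfY H with hGdef
  have hG : IsSelfAdjoint G := isSelfAdjoint_contraction _ hH
  set C := ⁅G, (chi halfW : LatticeSpace n →L[ℂ] LatticeSpace n)⁆ with hC
  set P : LatticeSpace n →L[ℂ] LatticeSpace n := chi halfY with hP
  set K := P * H * chi halfYᶜ * R * P
  set Q := P * R * P with hQ
  set u := delta j v
  set D : ℝ := ((1 + κ ^ 2 * (j.1 : ℝ) ^ 2) * (1 + (j.2 : ℝ) ^ 2))⁻¹ * ‖v‖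
  have hD : 0 ≤ D := by positivity
  let F : ℕ → LatticeSpace n →L[ℂ] LatticeSpace n := fun m =>
    cfc (fun t => φ t * (t - z) ^ m) G
  have hF0 : F 0 = cfc φ G := by simp [F]
  -- Where `φ` is nonzero, `|t - z| ≤ r'`; the functional calculus norm bound does the rest.
  have hFnorm : ∀ m, ‖F m‖ ≤ B * r' ^ m := fun m =>
    norm_cfc_le (by positivity) fun t _ => by
      by_cases ht : φ t = 0
      · rw [ht, zero_mul, norm_zero]; positivity
      · rw [norm_mul, norm_pow]
        exact mul_le_mul (hB t) (pow_le_pow_left₀ (norm_nonneg _) (hr' t ht) m) (by positivity) hB0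
  have hPC : P * C = C := chi_mul_commutator _ _ _
  have hPQ : P * Q = Q := by
    rw [hQ, ← mul_assoc, ← mul_assoc, hP, chi_mul_chi_self]
  have hrec : ∀ m, F m * P = F (m + 1) * Q + F m * K := fun m => by
    have h := contraction_sub_mul_compress halfY hLR
    have hs : F (m + 1) = F m * (G - algebraMap ℝ _ z) := cfc_mul_sub_pow_succ hG hφ z m
    rw [hs, mul_assoc, h, ← mul_add, sub_add_cancel]
  have hQnorm : ‖Q‖ ≤ r⁻¹ := by
    have hP1 : ‖P‖ ≤ 1 := norm_chi_le _
    calc ‖Q‖ ≤ ‖P‖ * ‖R‖ * ‖P‖ := (norm_mul_le _ _).trans (by gcongr; exact norm_mul_le _ _)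
      _ ≤ 1 * r⁻¹ * 1 := by gcongr
      _ = r⁻¹ := by ring
  rw [← hF0]
  exact norm_apply_le_of_parametrix hB0 hr'0 hc hρ hr'ρ hr hr'r hD hPQ hPC hrec hFnorm
    (norm_chi_le _) hQnorm (fun m => hest m j v)

end EdgeTrace

theorem mainTheorem4 (n : ℕ)
    (H : EdgeTrace.LatticeSpace n →L[ℂ] EdgeTrace.LatticeSpace n)
    (hH : IsSelfAdjoint H) (hdecay : EdgeTrace.RapidDecay H)
    (a b E : ℝ) (hE : E ∈ Set.Ioo a b) (hgap : Disjoint (Set.Ioo a b) (spectrum ℝ H))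
    (φ : ℝ → ℝ) (hφ : Continuous φ) (hφ_int : ∫ x, φ x = 1)
    (hφ_compact : HasCompactSupport φ) (hφ_supp : tsupport φ ⊆ Set.Ioo a b) :
    EdgeTrace.IsTraceClass
      (cfc φ (EdgeTrace.contraction EdgeTrace.halfY H) *
        (Complex.I • ⁅EdgeTrace.contraction EdgeTrace.halfY H,
          (EdgeTrace.chi EdgeTrace.halfW :
            EdgeTrace.LatticeSpace n →L[ℂ] EdgeTrace.LatticeSpace n)⁆)) := by
  -- The interval is recentred: `z = (a + b) / 2` and `r = (b - a) / 2`.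
  have hab : 0 < (b - a) / 2 := by linarith [hE.1, hE.2]
  have hgap' : ∀ t ∈ spectrum ℝ H, (b - a) / 2 ≤ |t - (a + b) / 2| := by
    intro t ht
    by_contra hlt
    rw [not_le, abs_lt] at hlt
    exact Set.disjoint_left.mp hgap ⟨by linarith, by linarith⟩ ht
  have hsupp : tsupport φ ⊆ Set.Ioo ((a + b) / 2 - (b - a) / 2) ((a + b) / 2 + (b - a) / 2) := by
    convert! hφ_supp using 2 <;> ring
  obtain ⟨κ, c, hκ, hle⟩ := EdgeTrace.exists_norm_cfc_mul_commutator_delta_le hH hdecay hab hgap'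
    hφ hφ_compact hsupp
  refine EdgeTrace.isTraceClass_of_summable_norm EdgeTrace.isParseval_deltaSingle
    (fun p => (EdgeTrace.norm_deltaSingle p).le) ?_
  have hsum : Summable fun p : (ℤ × ℤ) × Fin n =>
      c * ((1 + κ ^ 2 * (p.1.1 : ℝ) ^ 2) * (1 + (p.1.2 : ℝ) ^ 2))⁻¹ * 1 :=
    ((EdgeTrace.summable_lattice_weight (pow_pos hκ 2)).mul_of_nonneg
      (g := fun _ : Fin n => (1 : ℝ)) Summable.of_finite (fun s => by positivity)
      (fun _ => zero_le_one)).mul_left c |>.congr fun p => by ring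
  refine Summable.of_nonneg_of_le (fun _ => norm_nonneg _) (fun p => ?_) hsum
  have h := hle p.1 (EuclideanSpace.single p.2 1)
  rw [mul_smul_comm, smul_apply, norm_smul, Complex.norm_I, one_mul]
  simpa [EdgeTrace.deltaSingle, mul_assoc] using h
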